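/- Let $p,L\in\mathbb C$ with $|p|<1$, $L\neq 0$, and put $$\theta_1(u,p)=2p^{1/4}\sin(\pi u)\prod_{k\ge1}(1-2p^{2k}\cos 2\pi u+p^{4k})(1-p^{2k}),$$ $$[u]=\theta_1(u/L,p),\qquad [u]_k=[u][u-1]\cdots[u-k+1],\qquad \left[{u\atop k}\right]=\frac{[u]_k}{[k]_k}\quad(k\in\mathbb Z_{\ge0}).$$ Let $n\ge 0$ and $1\le l\le m$ be integers such that $[l]_l\ne0$ and $[m]_l\neq 0$. Let $\eta\in\mathbb C^{n+1}$ be generic, in the sense that $[\eta_i-\eta_j+k]\neq0$ for all $i\ne j$ and all $k\in\mathbb Z$. For $k\ge 0$ let $B_k=\{\alpha\in\mathbb Z_{\ge0}^{n+1}:\alpha_1+\cdots+\alpha_{n+1}=k\}$, and let $\mathbf e_1,\dots,\mathbf e_{n+1}$ be the standard basis vectors. For $a,b,c,d\in\eta+\mathbb Z^{n+1}$ and $l\ge1$ write $(\ast)_l$ for the condition $$d-a\in B_l,\qquad c-d\in B_m,\qquad c-b\in B_l,\qquad b-a\in B_m .$$ The weight for $l=1$ is $$\overline W_{1,m}\Bigl({a\;\;b\atop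 d\;\;c}\Bigl|u\Bigr)=\frac{[u+b_\nu-a_\mu]\prod_{j\ne\mu}[b_\nu-a_j+1]}{\prod_{j=1}^{n+1}[c_\nu-b_j]}\qquad(d=a+\mathbf e_\mu,\ c=b+\mathbf e_\nu)$$ if $(\ast)_1$ holds, and it is $0$ otherwise. If $(\ast)_l$ holds, then for a path $a=a^{(0)},a^{(1)},\dots,a^{(l)}=d$ with all $a^{(i+1)}-a^{(i)}\in B_1$ the fused weight and its normalization are $$\overline W_{l,m}\Bigl({a\;\;b\atop d\;\;c}\Bigl|u\Bigr)=\sum\prod_{i=0}^{l-1}\overline W_{1,m}\Bigl({a^{(i)}\;\;\;\;b^{(i)}\atop a^{(i+1)}\;\;b^{(i+1)}}\Bigl|u-i\Bigr),$$ $$W_{l,m}\Bigl({a\;\;b\atop d\;\;c}\Bigl|u\Bigr)=\overline W_{l,m}\Bigl({a\;\;b\atop d\;\;c}\Bigl|u\Bigr)\frac{[1]^l}{[l]_l}\left[{m\atop l}\right]^{-1},$$ where the sum is over all paths $b=b^{(0)},b^{(1)},\dots,b^{(l)}=c$ with all $b^{(i+1)}-b^{(i)}\in B_1$. Then, for all $a,b,c,d\in\eta+\mathbb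 Z^{n+1}$ satisfying $(\ast)_l$ and for every choice of the path $a^{(0)},\dots,a^{(l)}$, $$W_{l,m}\Bigl({a\;\;b\atop d\;\;c}\Bigl|u=0\Bigr)=\left[{m\atop l}\right]^{-1}\prod_{1\le i,j\le n+1}\frac{[c_i-d_j]_{c_i-b_i}}{[c_i-b_j]_{c_i-b_i}} .$$ -/

import Mathlib

noncomputable section

namespace FaceModel

/-- The Jacobi theta function
`θ₁(u, p) = 2 p^{1/4} sin(πu) ∏_{k ≥ 1} (1 - 2 p^{2k} cos(2πu) + p^{4k}) (1 - p^{2k})`, `|p| < 1`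
(the principal branch is taken for `p^{1/4}`). -/
def theta1 (u p : ℂ) : ℂ :=
  2 * p ^ (1 / 4 : ℂ) * Complex.sin (Real.pi * u) *
    ∏' k : ℕ, (1 - 2 * p ^ (2 * (k + 1)) * Complex.cos (2 * Real.pi * u) + p ^ (4 * (k + 1))) *
      (1 - p ^ (2 * (k + 1)))

/-- The elliptic symbol `[u] = θ₁(u / L, p)`. -/
def br (p L u : ℂ) : ℂ := theta1 (u / L) p

/-- The elliptic falling factorial `[u]_k = [u] [u - 1] ⋯ [u - k + 1]`. -/
def fall (p L u : ℂ) (k : ℕ) : ℂ := ∏ i ∈ Finset.range k, br p L (u - i)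

/-- The elliptic binomial `[u]_k / [k]_k`. -/
def binom (p L u : ℂ) (k : ℕ) : ℂ := fall p L u k / fall p L k k

/-- A local state is an element `η + x` of `η + ℤ^{n+1}`. It is represented by its integer
part `x`; its complex coordinates are given by `coord`. -/
abbrev State (n : ℕ) : Type := Fin (n + 1) → ℤ

/-- The `j`-th coordinate of the local state `η + x`. -/
def coord {n : ℕ} (η : Fin (n + 1) → ℂ) (x : State n) (j : Fin (n + 1)) : ℂ := η j + x j

/-- `B_m`: the vectors of nonnegative integers with coordinate sum `m`. -/
def B (n m : ℕ) : Set (Fin (n + 1) → ℤ) := {α | (∀ i, 0 ≤ α i) ∧ ∑ i, α i = (m : ℤ)}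

/-- The condition on the four states round a face
(upper left `a`, upper right `b`, lower left `d`, lower right `c`). -/
def IsFace {n : ℕ} (l m : ℕ) (a b d c : State n) : Prop :=
  d - a ∈ B n l ∧ c - d ∈ B n m ∧ c - b ∈ B n l ∧ b - a ∈ B n m

/-- Paths `x = s 0, s 1, …, s l = y` with every step in `B_1`. -/
def paths {n : ℕ} (l : ℕ) (x y : State n) : Set (Fin (l + 1) → State n) :=
  {s | s 0 = x ∧ s (Fin.last l) = y ∧ ∀ i : Fin l, s i.succ - s i.castSucc ∈ B n 1}

theorem paths_finite {n : ℕ} (l : ℕ) (x y : State n) : (paths l x y).Finite := by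
  refine Set.Finite.subset (Set.Finite.pi' (fun _ : Fin (l + 1) => Set.finite_Icc x y)) ?_
  rintro s ⟨h0, h1, hs⟩ i
  have hm : Monotone s := Fin.monotone_iff_le_succ.2 fun i j => by
    exact sub_nonneg.1 ((hs i).1 j)
  exact ⟨h0 ▸ hm (Fin.zero_le i), h1 ▸ hm (Fin.le_last i)⟩

open Classical in
/-- The unnormalized weight for `l = 1`: when `d = a + e_μ` and `c = b + e_ν` it is
`[u + b_ν - a_μ] ∏_{j ≠ μ} [b_ν - a_j + 1] / ∏_j [c_ν - b_j]`, and it is zero unless the four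
states satisfy the face condition. At most one pair `(μ, ν)` contributes to the sum. -/
def WbarOne {n : ℕ} (p L : ℂ) (η : Fin (n + 1) → ℂ) (m : ℕ) (a b d c : State n) (u : ℂ) : ℂ :=
  if IsFace 1 m a b d c then
    ∑ μ, ∑ ν, if d = a + Pi.single μ 1 ∧ c = b + Pi.single ν 1 then
      br p L (u + coord η b ν - coord η a μ) *
          (∏ j ∈ Finset.univ.erase μ, br p L (coord η b ν - coord η a j + 1)) /
        ∏ j, br p L (coord η c ν - coord η b j)
    else 0
  else 0

open Classical in
/-- The unnormalized fused weight, computed along a path `A` from `a` to `d`: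
the sum over all paths `s` from `b` to `c` of the products of the `l = 1` weights
at spectral parameters `u, u - 1, …, u - l + 1`. -/
def Wbar {n : ℕ} (p L : ℂ) (η : Fin (n + 1) → ℂ) (l m : ℕ) (A : Fin (l + 1) → State n)
    (a b d c : State n) (u : ℂ) : ℂ :=
  if IsFace l m a b d c then
    ∑ s ∈ (paths_finite l b c).toFinset, ∏ i : Fin l,
      WbarOne p L η m (A i.castSucc) (s i.castSucc) (A i.succ) (s i.succ) (u - (i : ℕ))
  else 0

/-- The normalized fused weight, computed along a path `A` from `a` to `d`. -/
def W {n : ℕ} (p L : ℂ) (η : Fin (n + 1) → ℂ) (l m : ℕ) (A : Fin (l + 1) → State n)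
    (a b d c : State n) (u : ℂ) : ℂ :=
  Wbar p L η l m A a b d c u * (br p L 1 ^ l / fall p L l l) * (binom p L m l)⁻¹

/-- The factorized weight. -/
def S {n : ℕ} (p L : ℂ) (η : Fin (n + 1) → ℂ) (l m : ℕ) (a b d c : State n) : ℂ :=
  (binom p L m l)⁻¹ * ∏ i, ∏ j,
    fall p L (coord η c i - coord η d j) (c i - b i).toNat /
      fall p L (coord η c i - coord η b j) (c i - b i).toNat

end FaceModel

end

/-! The proof is an induction on `l` that strips the last step from both paths. With `d = d' + e_μ`,
the fused weight of `(a, b, d, c)` is the sum over `ν` of the weight of `(a, b, d', c - e_ν)`, which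
factorizes by induction, times a single weight at parameter `u - l + 1`. The upper edge `a`, `b`
never changes. After removal of the common factors, the factorization for `l` becomes a partial
fraction identity for `[·]` with nodes `x_i = c_i`, `y_i = b_i` and `z = d_μ - 1`
(`partial_fractions`, `sum_factProd_shift`). That identity contains `[x_ν - z - ∑ (x_i - y_i)]`, and
since `∑ (c_i - b_i) = l` this is the `u`-dependent factor of the single weight exactly when `u =
0`. The closed form does not mention the path from `a` to `d`, so path independence comes for free.

Partial fractions use only that `[·]` is odd and satisfies the three-term relation. The latter is a
Plücker relation: `θ₁(x + y) θ₁(x - y)` is a 2 × 2 determinant in functions of `x` and `y`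
(`exists_theta1_mul`). The determinant is found by multiplying two theta series and splitting the
double sum by parity. Passing from the product defining `θ₁` to a series is the Jacobi triple
product, obtained here as a limit of its finite form. -/

noncomputable section

namespace FaceModel

open Filter Topology

/-! ### The Jacobi triple product -/

/-- The finite product `(q; q)_n`. -/
def qfac (q : ℂ) (n : ℕ) : ℂ := ∏ k ∈ Finset.range n, (1 - q ^ (k + 1))

/-- The reciprocal `1 / (q; q)_n`, extended by zero to negative integers. -/
def qfacInv (q : ℂ) (n : ℤ) : ℂ := if 0 ≤ n then (qfac q n.toNat)⁻¹ else 0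

theorem one_sub_pow_ne_zero {q : ℂ} (hq : ‖q‖ < 1) (n : ℕ) : 1 - q ^ (n + 1) ≠ 0 := by
  intro h
  have h1 : q ^ (n + 1) = 1 := (sub_eq_zero.1 h).symm
  have h2 : ‖q‖ ^ (n + 1) = 1 := by rw [← norm_pow, h1, norm_one]
  exact (pow_lt_one₀ (norm_nonneg q) hq n.succ_ne_zero).ne h2

/-- The extension by zero makes this recursion valid for every integer: at `n = 0` the factor `1 - q
^ n` vanishes. Finite sums can thus be treated as sums over all of `ℤ`. -/
theorem qfacInv_sub_one {q : ℂ} (hq : ‖q‖ < 1) (n : ℤ) :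
    qfacInv q (n - 1) = (1 - q ^ n) * qfacInv q n := by
  rcases lt_trichotomy n 0 with h | rfl | h
  · simp [qfacInv, not_le.2 h, not_le.2 (show n < 1 by omega)]
  · simp [qfacInv]
  · obtain ⟨k, rfl⟩ : ∃ k : ℕ, n = k + 1 := ⟨(n - 1).toNat, by omega⟩
    have h1 : ((k : ℤ) + 1).toNat = k + 1 := by omega
    have h2 : (0 : ℤ) ≤ k + 1 := by omega
    have h3 : q ^ ((k : ℤ) + 1) = q ^ (k + 1) := by norm_cast
    have h4 := one_sub_pow_ne_zero hq k
    simp only [qfacInv, h2, if_true, h1, h3, add_sub_cancel_right, Int.toNat_natCast,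
      Int.natCast_nonneg, qfac, Finset.prod_range_succ, mul_inv]
    field_simp

theorem hasSum_of_eq {f g : ℤ → ℂ} {s t : ℂ} (h : HasSum f s) (hf : ∀ n, g n = f n) (ht : t = s) :
    HasSum g t := by
  rwa [funext hf, ht]

/-- A finite form of the Jacobi triple product identity. -/
theorem hasSum_finite_triple_product {q z : ℂ} (hq : ‖q‖ < 1) (hq0 : q ≠ 0) (hz : z ≠ 0)
    {w : ℤ → ℂ} (hw0 : w 0 = 1) (hw : ∀ n, w (n + 1) = -(q ^ (n + 1) * z * w n)) (a b : ℕ) :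
    HasSum (fun n : ℤ => w n * qfacInv q (a - n) * qfacInv q (b + n))
      ((∏ k ∈ Finset.range a, (1 - q ^ (k + 1) * z)) * (∏ k ∈ Finset.range b, (1 - q ^ k / z)) /
        qfac q (a + b)) := by
  have key : ∀ n : ℕ, qfac q (n + 1) = qfac q n * (1 - q ^ (n + 1)) := fun n => by
    rw [qfac, Finset.prod_range_succ]; rfl
  induction b with
  | zero =>
    induction a with
    | zero =>
      have h := hasSum_single (f := fun n : ℤ => w n * qfacInv q ((0 : ℕ) - n) *
        qfacInv q ((0 : ℕ) + n)) 0 ?_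
      · convert h using 1
        simp [qfacInv, qfac, hw0]
      · intro n hn
        rcases lt_or_gt_of_ne hn with h | h
        · simp [qfacInv, not_le.2 h]
        · simp [qfacInv, not_le.2 h]
    | succ a ih =>
      have h1 := (Equiv.subRight (1 : ℤ)).hasSum_iff.2 ih
      -- Multiply by `(1 - q^(a+1) z) / (1 - q^(a+1))`, with the `z`-part shifted by one index. The
      -- coefficients recombine through `(1 - q^(a+1-n)) + q^(a+1-n) (1 - q^n) = 1 - q^(a+1)`.
      have h2 := (ih.sub (h1.mul_left (q ^ (a + 1) * z))).mul_left (1 - q ^ (a + 1))⁻¹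
      have h4 := one_sub_pow_ne_zero hq a
      refine hasSum_of_eq h2 (fun n => ?_) ?_
      · have e1 := qfacInv_sub_one hq (((a + 1 : ℕ) : ℤ) - n)
        have e2 := qfacInv_sub_one hq (((0 : ℕ) : ℤ) + n)
        have e3 := hw (n - 1)
        rw [sub_add_cancel] at e3
        have e4 : (((a + 1 : ℕ) : ℤ) - n - 1) = (a : ℤ) - n := by push_cast; ring
        have e5 : (a : ℤ) - (n - 1) = ((a + 1 : ℕ) : ℤ) - n := by push_cast; ring
        have e6 : q ^ (a + 1) = q ^ (((a + 1 : ℕ) : ℤ) - n) * q ^ n := by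
          rw [← zpow_add₀ hq0]; norm_num; norm_cast
        simp only [Function.comp, Equiv.subRight_apply]
        rw [e4] at e1
        rw [← add_sub_assoc, e1, e2, e5, e3, eq_inv_mul_iff_mul_eq₀ h4, e6]
        push_cast
        rw [zero_add]
        ring
      · rw [add_zero, add_zero, key, Finset.prod_range_succ]
        generalize ∏ k ∈ Finset.range a, (1 - q ^ (k + 1) * z) = P
        field_simp
  | succ b ih =>
    have h1 := (Equiv.addRight (1 : ℤ)).hasSum_iff.2 ih
    have h2 := (ih.sub (h1.mul_left (q ^ b / z))).mul_left (1 - q ^ (a + b + 1))⁻¹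
    have h4 := one_sub_pow_ne_zero hq (a + b)
    refine hasSum_of_eq h2 (fun n => ?_) ?_
    · have e1 := qfacInv_sub_one hq (((b + 1 : ℕ) : ℤ) + n)
      have e2 := qfacInv_sub_one hq ((a : ℤ) - n)
      have e3 := hw n
      have e4 : (((b + 1 : ℕ) : ℤ) + n - 1) = (b : ℤ) + n := by push_cast; ring
      have e5 : (b : ℤ) + (n + 1) = ((b + 1 : ℕ) : ℤ) + n := by push_cast; ring
      have e6 : q ^ (a + b + 1) = q ^ ((a : ℤ) - n) * (q ^ b * q ^ (n + 1)) := by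
        rw [← zpow_natCast q b, ← zpow_add₀ hq0, ← zpow_add₀ hq0, ← zpow_natCast]
        congr 1; push_cast; ring
      have e7 : q ^ (((b + 1 : ℕ) : ℤ) + n) = q ^ b * q ^ (n + 1) := by
        rw [← zpow_natCast q b, ← zpow_add₀ hq0]
        congr 1; push_cast; ring
      simp only [Function.comp, Equiv.coe_addRight]
      rw [e4, e7] at e1
      rw [← sub_sub, e1, e2, e5, e3, eq_inv_mul_iff_mul_eq₀ h4, e6]
      field_simp
      ring
    · rw [← add_assoc, key, Finset.prod_range_succ]
      generalize ∏ k ∈ Finset.range a, (1 - q ^ (k + 1) * z) = P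
      generalize ∏ k ∈ Finset.range b, (1 - q ^ k / z) = P'
      field_simp

theorem multipliable_one_sub_pow_mul {q : ℂ} (hq : ‖q‖ < 1) (t : ℂ) :
    Multipliable fun k : ℕ => 1 - q ^ (k + 1) * t := by
  have h : Summable fun k : ℕ => ‖-(q ^ (k + 1) * t)‖ := by
    simp_rw [norm_neg, norm_mul, norm_pow, pow_succ]
    exact ((summable_geometric_of_lt_one (norm_nonneg _) hq).mul_right _).mul_right _
  have h' := multipliable_one_add_of_summable h
  simp_rw [← sub_eq_add_neg] at h'
  exact h'

/-- Since `1 / (1 - q^k) = 1 + q^k / (1 - q^k)`, the reciprocals themselves form an absolutely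
convergent product. -/
theorem exists_tendsto_qfac_inv {q : ℂ} (hq : ‖q‖ < 1) :
    ∃ c, Tendsto (fun n => (qfac q n)⁻¹) atTop (𝓝 c) := by
  have hs : Summable fun k : ℕ => q ^ (k + 1) / (1 - q ^ (k + 1)) := by
    have h0 : Summable fun k : ℕ => ‖q‖ ^ (k + 1) / (1 - ‖q‖) := by
      simp_rw [pow_succ]
      exact ((summable_geometric_of_lt_one (norm_nonneg q) hq).mul_right _).div_const _
    refine h0.of_norm_bounded fun k => ?_
    rw [norm_div, norm_pow]
    have h1 : 1 - ‖q‖ ≤ ‖1 - q ^ (k + 1)‖ := by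
      have h2 := norm_sub_norm_le (1 : ℂ) (q ^ (k + 1))
      rw [norm_one, norm_pow] at h2
      have h3 : ‖q‖ ^ (k + 1) ≤ ‖q‖ := pow_le_of_le_one (norm_nonneg q) hq.le k.succ_ne_zero
      linarith
    have h4 : 0 < 1 - ‖q‖ := by linarith
    gcongr
  have hm := (multipliable_one_add_of_summable (f := fun k : ℕ => q ^ (k + 1) / (1 - q ^ (k + 1)))
    hs.norm).hasProd.tendsto_prod_nat
  refine ⟨_, hm.congr fun n => ?_⟩
  rw [qfac, ← Finset.prod_inv_distrib]
  refine Finset.prod_congr rfl fun k _ => ?_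
  have h4 := one_sub_pow_ne_zero hq k
  field_simp
  ring

/-- Dominated convergence in the finite identity, with bound `‖w n‖ K²`. Taking `N + 1` factors on
the second side leaves, apart from `1 - 1 / z`, equally many on both sides; that extra factor later
becomes the sine. -/
theorem tendsto_triple_product {q z : ℂ} (hq : ‖q‖ < 1) (hq0 : q ≠ 0) (hz : z ≠ 0)
    {w : ℤ → ℂ} (hw0 : w 0 = 1) (hw : ∀ n, w (n + 1) = -(q ^ (n + 1) * z * w n))
    (hws : Summable w) {c : ℂ} (hc : Tendsto (fun n => (qfac q n)⁻¹) atTop (𝓝 c)) :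
    Tendsto (fun N : ℕ => (∏ k ∈ Finset.range N, (1 - q ^ (k + 1) * z)) *
      (∏ k ∈ Finset.range (N + 1), (1 - q ^ k / z)) / qfac q (N + (N + 1))) atTop
      (𝓝 (∑' n, w n * c * c)) := by
  obtain ⟨K, hK⟩ : ∃ K : ℝ, ∀ n, ‖qfacInv q n‖ ≤ K := by
    obtain ⟨K, hK⟩ := hc.norm.bddAbove_range
    refine ⟨K, fun n => ?_⟩
    by_cases h : 0 ≤ n
    · simpa only [qfacInv, h, if_true] using hK ⟨n.toNat, rfl⟩
    · simpa only [qfacInv, h, if_false, norm_zero] using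
        (norm_nonneg _).trans (hK ⟨0, rfl⟩)
  have hlim : Tendsto (qfacInv q) atTop (𝓝 c) := by
    have h1 : Tendsto (fun n : ℤ => (qfac q n.toNat)⁻¹) atTop (𝓝 c) := by
      refine hc.comp (tendsto_atTop_atTop.2 fun b => ⟨b, fun a ha => by omega⟩)
    refine h1.congr' ?_
    filter_upwards [eventually_ge_atTop 0] with n hn
    simp [qfacInv, hn]
  have h := tendsto_tsum_of_dominated_convergence (𝓕 := atTop)
    (f := fun (N : ℕ) (n : ℤ) => w n * qfacInv q ((N : ℤ) - n) * qfacInv q ((N + 1 : ℕ) + n))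
    (g := fun n => w n * c * c) (bound := fun n => ‖w n‖ * K * K)
    ((hws.norm.mul_right K).mul_right K) ?_ ?_
  · refine h.congr fun N => ?_
    exact (hasSum_finite_triple_product hq hq0 hz hw0 hw N (N + 1)).tsum_eq
  · intro n
    refine (tendsto_const_nhds.mul (hlim.comp ?_)).mul (hlim.comp ?_)
    · exact tendsto_atTop_add_const_right _ _ tendsto_natCast_atTop_atTop
    · exact tendsto_atTop_add_const_right _ _
        (tendsto_natCast_atTop_atTop.comp (tendsto_add_atTop_nat 1))
  · refine Eventually.of_forall fun N n => ?_
    rw [norm_mul, norm_mul]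
    have := hK 0
    have hK0 : 0 ≤ K := (norm_nonneg _).trans this
    gcongr
    · exact hK _
    · exact hK _

/-- The theta function is, up to a constant, the value of Mathlib's two-variable theta series
at `u + τ / 2 + 1 / 2`, where `p = exp (π i τ)`. -/
theorem exists_theta1_eq {p τ : ℂ} (hτ : 0 < τ.im)
    (hpτ : p = Complex.exp (Real.pi * Complex.I * τ)) :
    ∃ C : ℂ, ∀ u : ℂ, theta1 u p =
      C * (Complex.exp (Real.pi * Complex.I * u) * jacobiTheta₂ (u + τ / 2 + 1 / 2) τ) := by
  have hp0 : p ≠ 0 := hpτ ▸ Complex.exp_ne_zero _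
  have hp : ‖p‖ < 1 := by
    rw [hpτ, Complex.norm_exp, Real.exp_lt_one_iff]
    have : (Real.pi * Complex.I * τ).re = -(Real.pi * τ.im) := by simp
    rw [this]
    have := mul_pos Real.pi_pos hτ
    linarith
  have hq : ‖p ^ 2‖ < 1 := by rw [norm_pow]; exact pow_lt_one₀ (norm_nonneg p) hp two_ne_zero
  have hq0 : p ^ 2 ≠ 0 := pow_ne_zero 2 hp0
  obtain ⟨c, hc⟩ := exists_tendsto_qfac_inv hq
  have hm := multipliable_one_sub_pow_mul hq
  set D := ∏' k : ℕ, (1 - (p ^ 2) ^ (k + 1) * 1)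
  have hD : Tendsto (qfac (p ^ 2)) atTop (𝓝 D) := by
    refine (hm 1).hasProd.tendsto_prod_nat.congr fun n => ?_
    simp [qfac]
  -- As `D * c = 1`, this constant is just `-i p^(1/4)`.
  refine ⟨-Complex.I * p ^ (1 / 4 : ℂ) * D * D * c * c, fun u => ?_⟩
  set z := Complex.exp (2 * Real.pi * Complex.I * u) with hz
  have hz0 : z ≠ 0 := Complex.exp_ne_zero _
  set w : ℤ → ℂ := fun n => jacobiTheta₂_term n (u + τ / 2 + 1 / 2) τ with hw
  have hw0 : w 0 = 1 := by simp [hw, jacobiTheta₂_term]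
  have hw1 : ∀ n, w (n + 1) = -((p ^ 2) ^ (n + 1) * z * w n) := fun n => by
    simp only [hw, hz, jacobiTheta₂_term, hpτ]
    rw [← Complex.exp_nat_mul, ← Complex.exp_int_mul, ← Complex.exp_add, ← Complex.exp_add,
      neg_eq_neg_one_mul, ← Complex.exp_pi_mul_I, ← Complex.exp_add]
    congr 1
    push_cast
    ring
  have hws : Summable w := (summable_jacobiTheta₂_term_iff _ _).2 hτ
  have h1 := tendsto_triple_product hq hq0 hz0 hw0 hw1 hws hc
  have h2 : Tendsto (fun N : ℕ => (∏ k ∈ Finset.range N, (1 - (p ^ 2) ^ (k + 1) * z)) *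
      (∏ k ∈ Finset.range (N + 1), (1 - (p ^ 2) ^ k / z))) atTop
      (𝓝 ((∏' k : ℕ, (1 - (p ^ 2) ^ (k + 1) * z)) * ((1 - 1 / z) *
        ∏' k : ℕ, (1 - (p ^ 2) ^ (k + 1) * z⁻¹)))) := by
    refine (hm z).hasProd.tendsto_prod_nat.mul ?_
    refine ((hm z⁻¹).hasProd.tendsto_prod_nat.const_mul (1 - 1 / z)).congr fun n => ?_
    rw [Finset.prod_range_succ', pow_zero, mul_comm]
    rfl
  have h3 := tendsto_nhds_unique h1 (h2.mul (hc.comp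
    (show Tendsto (fun N : ℕ => N + (N + 1)) atTop atTop from
      tendsto_atTop_mono (fun N => by simp only [id]; omega) tendsto_id)))
  have hcD : D * c = 1 := by
    refine tendsto_nhds_unique (hD.mul hc) (tendsto_const_nhds.congr fun n => ?_)
    exact (mul_inv_cancel₀ (Finset.prod_ne_zero_iff.2 fun k _ => one_sub_pow_ne_zero hq k)).symm
  have h4 : ∏' k : ℕ, (1 - 2 * p ^ (2 * (k + 1)) * Complex.cos (2 * Real.pi * u) +
      p ^ (4 * (k + 1))) * (1 - p ^ (2 * (k + 1))) =
      (∏' k : ℕ, (1 - (p ^ 2) ^ (k + 1) * z)) * (∏' k : ℕ, (1 - (p ^ 2) ^ (k + 1) * z⁻¹)) * D := by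
    rw [← (hm _).tprod_mul (hm _), ← ((hm _).mul (hm _)).tprod_mul (hm _)]
    refine tprod_congr fun k => ?_
    have h5 : 2 * Complex.cos (2 * Real.pi * u) = z + z⁻¹ := by
      rw [Complex.two_cos, hz, ← Complex.exp_neg]
      congr 2 <;> ring
    have h6 : z * z⁻¹ = 1 := mul_inv_cancel₀ hz0
    rw [pow_mul, show 4 * (k + 1) = 2 * (2 * (k + 1)) by ring, pow_mul p 2, pow_mul' _ 2]
    linear_combination (-(p ^ 2) ^ (k + 1) * h5 - ((p ^ 2) ^ (k + 1)) ^ 2 * h6) *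
      (1 - (p ^ 2) ^ (k + 1))
  have h7 : 2 * Complex.sin (Real.pi * u) =
      -Complex.I * Complex.exp (Real.pi * Complex.I * u) * (1 - 1 / z) := by
    have e1 : Complex.exp (Real.pi * Complex.I * u) * (1 / z) =
        Complex.exp (-(Real.pi * u) * Complex.I) := by
      rw [one_div, hz, ← Complex.exp_neg, ← Complex.exp_add]
      congr 1; ring
    have e2 : Complex.exp (Real.pi * u * Complex.I) = Complex.exp (Real.pi * Complex.I * u) := by
      congr 1; ring
    rw [Complex.two_sin, e2, ← e1]
    ring
  have h8 : jacobiTheta₂ (u + τ / 2 + 1 / 2) τ = ∑' n, w n := rfl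
  rw [tsum_mul_right, tsum_mul_right] at h3
  rw [theta1, h4, h8]
  set P₁ := ∏' k : ℕ, (1 - (p ^ 2) ^ (k + 1) * z)
  set P₂ := ∏' k : ℕ, (1 - (p ^ 2) ^ (k + 1) * z⁻¹)
  set E := Complex.exp (Real.pi * Complex.I * u)
  linear_combination p ^ (1 / 4 : ℂ) * P₁ * P₂ * D * h7 +
    Complex.I * p ^ (1 / 4 : ℂ) * E * D * D * h3 +
    Complex.I * p ^ (1 / 4 : ℂ) * E * D * P₁ * P₂ * (1 - 1 / z) * hcD

/-! ### Products of two theta values and the rank-two formula -/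

/-- Pairs of integers, split according to the parity of their sum. -/
def sumDiffEquiv : (ℤ × ℤ) ⊕ (ℤ × ℤ) ≃ ℤ × ℤ where
  toFun := Sum.elim (fun x => (x.1 + x.2, x.1 - x.2)) (fun x => (x.1 + x.2, x.1 - x.2 - 1))
  invFun y := if (y.1 + y.2) % 2 = 0 then Sum.inl ((y.1 + y.2) / 2, (y.1 - y.2) / 2)
    else Sum.inr ((y.1 + y.2 + 1) / 2, (y.1 - y.2 - 1) / 2)
  left_inv := by
    rintro (⟨i, j⟩ | ⟨i, j⟩)
    · have h : (i + j + (i - j)) % 2 = 0 := by omega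
      simp only [Sum.elim_inl, h, if_true, Sum.inl.injEq, Prod.mk.injEq]
      omega
    · have h : ¬ (i + j + (i - j - 1)) % 2 = 0 := by omega
      simp only [Sum.elim_inr, h, if_false, Sum.inr.injEq, Prod.mk.injEq]
      omega
  right_inv := by
    rintro ⟨i, j⟩
    by_cases h : (i + j) % 2 = 0
    · simp only [h, if_true, Sum.elim_inl, Prod.mk.injEq]
      omega
    · simp only [h, if_false, Sum.elim_inr, Prod.mk.injEq]
      omega

theorem hasSum_jacobiTheta₂_term (z : ℂ) {τ : ℂ} (hτ : 0 < τ.im) :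
    HasSum (jacobiTheta₂_term · z τ) (jacobiTheta₂ z τ) :=
  ((summable_jacobiTheta₂_term_iff z τ).2 hτ).hasSum

theorem hasSum_mul_prod {f g : ℤ → ℂ} {s t : ℂ} (hf : HasSum f s) (hg : HasSum g t) :
    HasSum (fun x : ℤ × ℤ => f x.1 * g x.2) (s * t) :=
  hf.mul hg (summable_mul_of_summable_norm hf.summable.norm hg.summable.norm)

theorem hasSum_congr_fun {ι : Type*} {f g : ι → ℂ} {s : ℂ} (h : ∀ i, f i = g i) :
    HasSum f s ↔ HasSum g s := by
  rw [funext h]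

theorem jacobiTheta₂_term_mul_even (τ x y : ℂ) (i j : ℤ) :
    (Complex.exp (Real.pi * Complex.I * (x + y)) *
        jacobiTheta₂_term (i + j) (x + y + τ / 2 + 1 / 2) τ) *
      (Complex.exp (Real.pi * Complex.I * (x - y)) *
        jacobiTheta₂_term (i - j) (x - y + τ / 2 + 1 / 2) τ) =
    (Complex.exp (2 * Real.pi * Complex.I * x) * jacobiTheta₂_term i (2 * x + τ) (2 * τ)) *
      jacobiTheta₂_term j (2 * y) (2 * τ) := by
  simp only [jacobiTheta₂_term, ← Complex.exp_add]
  -- The shifts by `1/2` contribute `πi ((i + j) + (i - j)) = 2πi · i`. In the odd case the index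
  -- sum is `2i - 1`, whence the minus sign there.
  refine Complex.exp_eq_exp_iff_exists_int.2 ⟨i, ?_⟩
  push_cast
  ring

theorem jacobiTheta₂_term_mul_odd (τ x y : ℂ) (i j : ℤ) :
    (Complex.exp (Real.pi * Complex.I * (x + y)) *
        jacobiTheta₂_term (i + j) (x + y + τ / 2 + 1 / 2) τ) *
      (Complex.exp (Real.pi * Complex.I * (x - y)) *
        jacobiTheta₂_term (i - j - 1) (x - y + τ / 2 + 1 / 2) τ) =
    -(jacobiTheta₂_term i (2 * x) (2 * τ) *
      (Complex.exp (2 * Real.pi * Complex.I * y) *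
        jacobiTheta₂_term j (2 * y + τ) (2 * τ))) := by
  simp only [jacobiTheta₂_term, ← Complex.exp_add]
  rw [neg_eq_neg_one_mul, ← Complex.exp_pi_mul_I, ← Complex.exp_add]
  refine Complex.exp_eq_exp_iff_exists_int.2 ⟨i - 1, ?_⟩
  push_cast
  ring

theorem exp_mul_jacobiTheta₂_mul {τ : ℂ} (hτ : 0 < τ.im) (x y : ℂ) :
    (Complex.exp (Real.pi * Complex.I * (x + y)) * jacobiTheta₂ (x + y + τ / 2 + 1 / 2) τ) *
      (Complex.exp (Real.pi * Complex.I * (x - y)) * jacobiTheta₂ (x - y + τ / 2 + 1 / 2) τ) =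
    (Complex.exp (2 * Real.pi * Complex.I * x) * jacobiTheta₂ (2 * x + τ) (2 * τ)) *
      jacobiTheta₂ (2 * y) (2 * τ) -
    jacobiTheta₂ (2 * x) (2 * τ) *
      (Complex.exp (2 * Real.pi * Complex.I * y) * jacobiTheta₂ (2 * y + τ) (2 * τ)) := by
  have hτ2 : 0 < (2 * τ).im := by simpa using hτ
  have h1 := hasSum_mul_prod
    ((hasSum_jacobiTheta₂_term (x + y + τ / 2 + 1 / 2) hτ).mul_left
      (Complex.exp (Real.pi * Complex.I * (x + y))))
    ((hasSum_jacobiTheta₂_term (x - y + τ / 2 + 1 / 2) hτ).mul_left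
      (Complex.exp (Real.pi * Complex.I * (x - y))))
  have h2 := hasSum_mul_prod ((hasSum_jacobiTheta₂_term (2 * x + τ) hτ2).mul_left
    (Complex.exp (2 * Real.pi * Complex.I * x))) (hasSum_jacobiTheta₂_term (2 * y) hτ2)
  have h3 := (hasSum_mul_prod (hasSum_jacobiTheta₂_term (2 * x) hτ2)
    ((hasSum_jacobiTheta₂_term (2 * y + τ) hτ2).mul_left
      (Complex.exp (2 * Real.pi * Complex.I * y)))).neg
  refine ((sumDiffEquiv.hasSum_iff.2 h1).unique (HasSum.sum
    ((hasSum_congr_fun fun v => ?_).2 h2) ((hasSum_congr_fun fun v => ?_).2 h3))).trans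
    (sub_eq_add_neg _ _).symm
  · exact jacobiTheta₂_term_mul_even τ x y v.1 v.2
  · exact jacobiTheta₂_term_mul_odd τ x y v.1 v.2

/-- Antisymmetric products of theta functions have rank two. -/
theorem exists_theta1_mul {p : ℂ} (hp : ‖p‖ < 1) (hp0 : p ≠ 0) :
    ∃ A B : ℂ → ℂ, ∀ x y, theta1 (x + y) p * theta1 (x - y) p = B x * A y - A x * B y := by
  set τ : ℂ := Complex.log p / (Real.pi * Complex.I) with hτdef
  have hpi : (Real.pi : ℂ) * Complex.I ≠ 0 :=
    mul_ne_zero (Complex.ofReal_ne_zero.2 Real.pi_ne_zero) Complex.I_ne_zero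
  have hpτ : p = Complex.exp (Real.pi * Complex.I * τ) := by
    rw [hτdef, mul_div_cancel₀ _ hpi, Complex.exp_log hp0]
  have hτ : 0 < τ.im := by
    have h1 : ‖p‖ = Real.exp (-(Real.pi * τ.im)) := by
      conv_lhs => rw [hpτ]
      rw [Complex.norm_exp]
      simp
    rw [h1, Real.exp_lt_one_iff] at hp
    exact pos_of_mul_pos_right (neg_lt_zero.1 hp) Real.pi_pos.le
  obtain ⟨C, hC⟩ := exists_theta1_eq hτ hpτ
  refine ⟨fun y => C * jacobiTheta₂ (2 * y) (2 * τ), fun x => C *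
    (Complex.exp (2 * Real.pi * Complex.I * x) * jacobiTheta₂ (2 * x + τ) (2 * τ)), fun x y => ?_⟩
  rw [hC, hC]
  linear_combination C ^ 2 * exp_mul_jacobiTheta₂_mul hτ x y

/-! ### Three-term relation and partial fractions -/

theorem br_neg (p L u : ℂ) : br p L (-u) = -br p L u := by
  simp only [br, theta1, neg_div, mul_neg, Complex.sin_neg, Complex.cos_neg, neg_mul]

theorem br_zero (p L : ℂ) : br p L 0 = 0 := by simp [br, theta1]

/-- The three-term relation for the elliptic symbol. -/
theorem br_three_term {p : ℂ} (hp : ‖p‖ < 1) (hp0 : p ≠ 0) (L a b y s z : ℂ) :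
    br p L (s + b - y) * br p L (a - z - s) * br p L (y - z) * br p L (a - b) =
      br p L (a - z - (s + b - y)) * br p L (b - z) * br p L s * br p L (a - y) -
      br p L (y - z - s) * br p L (a - z) * br p L (b - a + s) * br p L (b - y) := by
  obtain ⟨A, B, hAB⟩ := exists_theta1_mul hp hp0
  -- Each of the six products of two brackets is a 2 × 2 minor of the vectors `(A, B)` at four
  -- points `X`, `Y`, `Z`, `V`. The claim is the Plücker relation `XY · ZV - XZ · YV + XV · YZ = 0`.
  have key : ∀ u v x y : ℂ, u = x + y → v = x - y →
      br p L u * br p L v = B (x / L) * A (y / L) - A (x / L) * B (y / L) := fun u v x y hu hv => by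
    rw [br, br, hu, hv, add_div, sub_div, hAB]
  have h1 := key (s + b - y) (a - z - s) ((a + b - y - z) / 2) (s + (b - y - a + z) / 2)
    (by ring) (by ring)
  have h2 := key (y - z) (a - b) ((y - z + a - b) / 2) ((y - z - a + b) / 2) (by ring) (by ring)
  have h3 := key (a - z) (b - y) ((a + b - y - z) / 2) ((y - z + a - b) / 2) (by ring) (by ring)
  have h4 := key (b - a + s) (-(y - z - s)) (s + (b - y - a + z) / 2) ((y - z - a + b) / 2)
    (by ring) (by ring)
  have h5 := key (b - z) (a - y) ((a + b - y - z) / 2) ((y - z - a + b) / 2) (by ring) (by ring)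
  have h6 := key s (-(a - z - (s + b - y))) (s + (b - y - a + z) / 2) ((y - z + a - b) / 2)
    (by ring) (by ring)
  rw [br_neg] at h4 h6
  generalize (a + b - y - z) / 2 / L = X at h1 h3 h5
  generalize (s + (b - y - a + z) / 2) / L = Y at h1 h4 h6
  generalize (y - z + a - b) / 2 / L = Z at h2 h3 h6
  generalize (y - z - a + b) / 2 / L = V at h2 h4 h5
  linear_combination br p L (y - z) * br p L (a - b) * h1 + (B X * A Y - A X * B Y) * h2 +
    br p L s * -br p L (a - z - (s + b - y)) * h5 + (B X * A V - A X * B V) * h6 -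
    br p L (b - a + s) * -br p L (y - z - s) * h3 - (B X * A Z - A X * B Z) * h4

/-- The partial fraction expansion for odd functions satisfying the three-term relation. -/
theorem partial_fractions {f : ℂ → ℂ} (hodd : ∀ x, f (-x) = -f x)
    (hf : ∀ a b y s z, f (s + b - y) * f (a - z - s) * f (y - z) * f (a - b) =
      f (a - z - (s + b - y)) * f (b - z) * f s * f (a - y) -
      f (y - z - s) * f (a - z) * f (b - a + s) * f (b - y))
    {ι : Type*} [DecidableEq ι] (x y : ι → ℂ) (z : ℂ) (T : Finset ι) (hT : T.Nonempty)
    (hx : ∀ i ∈ T, ∀ j ∈ T, i ≠ j → f (x i - x j) ≠ 0)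
    (hs : ∀ U ⊆ T, U.Nonempty → f (∑ i ∈ U, (x i - y i)) ≠ 0) :
    f (∑ i ∈ T, (x i - y i)) * ∏ i ∈ T, f (y i - z) =
      ∑ k ∈ T, f (x k - z - ∑ i ∈ T, (x i - y i)) * (∏ i ∈ T.erase k, f (x i - z)) *
        ((∏ j ∈ T, f (x k - y j)) / ∏ j ∈ T.erase k, f (x k - x j)) := by
  induction T using Finset.induction_on generalizing z with
  | empty => exact absurd hT Finset.not_nonempty_empty
  | insert b T hb ih =>
    rcases T.eq_empty_or_nonempty with rfl | hTn
    · simp only [insert_empty_eq, Finset.sum_singleton, Finset.prod_singleton,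
        Finset.erase_singleton, Finset.prod_empty, mul_one, div_one]
      rw [mul_comm, show x b - z - (x b - y b) = y b - z by ring]
    have hxT : ∀ i ∈ T, ∀ j ∈ T, i ≠ j → f (x i - x j) ≠ 0 := fun i hi j hj =>
      hx i (Finset.mem_insert_of_mem hi) j (Finset.mem_insert_of_mem hj)
    have hsT : ∀ U ⊆ T, U.Nonempty → f (∑ i ∈ U, (x i - y i)) ≠ 0 := fun U hU =>
      hs U (hU.trans (Finset.subset_insert b T))
    have hxb : ∀ i ∈ T, f (x i - x b) ≠ 0 := fun i hi =>
      hx i (Finset.mem_insert_of_mem hi) b (Finset.mem_insert_self b T)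
        (fun h => hb (h ▸ hi))
    have hne : ∀ i ∈ T, b ≠ i := fun i hi h => hb (h ▸ hi)
    have hs0 := hsT T subset_rfl hTn
    obtain ⟨c, hc⟩ : ∃ c : ι → ℂ, ∀ k,
        (∏ j ∈ T, f (x k - y j)) / ∏ j ∈ T.erase k, f (x k - x j) = c k := ⟨_, fun _ => rfl⟩
    simp only [hc] at ih
    -- The hypothesis is used at `z` for the left side and at `x b` for the coefficient of the new
    -- term `k = b`. Both uses produce a factor `f s`, which is why the goal is multiplied by it and
    -- partial sums must not be zeros of `f`. The sums then agree term by term by the three-term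
    -- relation.
    have ihz := ih z hTn hxT hsT
    have ihb := ih (x b) hTn hxT hsT
    set s := ∑ i ∈ T, (x i - y i)
    rw [Finset.sum_insert hb, Finset.sum_insert hb, Finset.prod_insert hb, Finset.prod_insert hb,
      Finset.erase_insert hb, show x b - y b + s = s + x b - y b by ring]
    refine mul_left_cancel₀ hs0 ?_
    have h1 : ∀ k ∈ T, f (x k - z - (s + x b - y b)) *
        (∏ i ∈ (insert b T).erase k, f (x i - z)) *
        ((∏ j ∈ insert b T, f (x k - y j)) / ∏ j ∈ (insert b T).erase k, f (x k - x j)) =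
        f (x k - z - (s + x b - y b)) * (f (x b - z) * ∏ i ∈ T.erase k, f (x i - z)) *
        (f (x k - y b) * c k / f (x k - x b)) := fun k hk => by
      have h2 : b ∉ T.erase k := fun h => hb (Finset.mem_of_mem_erase h)
      rw [Finset.erase_insert_of_ne (hne k hk), Finset.prod_insert h2, Finset.prod_insert h2,
        Finset.prod_insert hb, ← hc]
      simp only [div_eq_mul_inv, mul_inv]
      ring
    rw [Finset.sum_congr rfl h1]
    have h3 : (∏ j ∈ T, f (x b - y j)) = (-1) ^ T.card * ∏ j ∈ T, f (y j - x b) := by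
      rw [← Finset.prod_const, ← Finset.prod_mul_distrib]
      exact Finset.prod_congr rfl fun j _ => by rw [← neg_sub, hodd]; ring
    have h4 : (∏ j ∈ T, f (x b - x j)) = (-1) ^ T.card * ∏ j ∈ T, f (x j - x b) := by
      rw [← Finset.prod_const, ← Finset.prod_mul_distrib]
      exact Finset.prod_congr rfl fun j _ => by rw [← neg_sub, hodd]; ring
    have h5 : ∏ j ∈ T, f (x j - x b) ≠ 0 := Finset.prod_ne_zero_iff.2 hxb
    have h6 : (∏ j ∈ T, f (x b - y j)) / ∏ j ∈ T, f (x b - x j) =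
        (∏ j ∈ T, f (y j - x b)) / ∏ j ∈ T, f (x j - x b) := by
      rw [h3, h4, mul_div_mul_left _ _ (pow_ne_zero _ (by norm_num))]
    have h7 : f s * ((∏ j ∈ T, f (y j - x b)) / ∏ j ∈ T, f (x j - x b)) =
        ∑ k ∈ T, f (x k - x b - s) / f (x k - x b) * c k := by
      rw [← mul_div_assoc, ihb, Finset.sum_div]
      refine Finset.sum_congr rfl fun k hk => ?_
      rw [← Finset.mul_prod_erase T (fun i => f (x i - x b)) hk] at h5 ⊢
      have h8 := left_ne_zero_of_mul h5
      have h9 := right_ne_zero_of_mul h5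
      field_simp
    rw [mul_div_assoc (f (x b - y b)), h6, mul_add, Finset.mul_sum]
    calc f s * (f (s + x b - y b) * (f (y b - z) * ∏ i ∈ T, f (y i - z)))
        = f (s + x b - y b) * f (y b - z) * (f s * ∏ i ∈ T, f (y i - z)) := by ring
      _ = f (x b - z - (s + x b - y b)) * (∏ i ∈ T, f (x i - z)) * f (x b - y b) *
            (f s * ((∏ j ∈ T, f (y j - x b)) / ∏ j ∈ T, f (x j - x b))) +
          ∑ k ∈ T, f s * (f (x k - z - (s + x b - y b)) *
            (f (x b - z) * ∏ i ∈ T.erase k, f (x i - z)) *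
            (f (x k - y b) * c k / f (x k - x b))) := by
          rw [ihz, h7, Finset.mul_sum, Finset.mul_sum, ← Finset.sum_add_distrib]
          refine Finset.sum_congr rfl fun k hk => ?_
          have h8 := hxb k hk
          have h9 := hf (x k) (x b) (y b) s z
          have e1 : f (x k - x b - s) = -f (x b - x k + s) := by rw [← hodd]; congr 1; ring
          have e2 : x b - z - (s + x b - y b) = y b - z - s := by ring
          rw [← Finset.mul_prod_erase T _ hk, e1, e2]
          field_simp
          linear_combination (∏ i ∈ T.erase k, f (x i - z)) * c k * h9
      _ = _ := by
          ring

/-! ### Elliptic factorials and the one-step recursion of the factorized product -/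

theorem fall_zero (p L u : ℂ) : fall p L u 0 = 1 := by simp [fall]

theorem fall_succ (p L u : ℂ) (k : ℕ) : fall p L u (k + 1) = fall p L u k * br p L (u - k) :=
  Finset.prod_range_succ _ _

theorem fall_succ' (p L u : ℂ) (k : ℕ) : fall p L u (k + 1) = br p L u * fall p L (u - 1) k := by
  rw [fall, Finset.prod_range_succ', mul_comm]
  congr 1
  · simp
  · refine Finset.prod_congr rfl fun i _ => ?_
    congr 1
    push_cast
    ring

/-- Splits off the last factor of each factorial, which is `[x_i - t - k_i + 1] = [y_i - (t - 1)]`.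
-/
theorem prod_fall_eq_mul {ι : Type*} [Fintype ι] (p L : ℂ) {x y : ι → ℂ} {k : ι → ℕ}
    (hxy : ∀ i, x i = y i + k i) (t : ℂ) :
    ∏ i, fall p L (x i - t) (k i) =
      (∏ i with 0 < k i, fall p L (x i - t) (k i - 1)) *
        ∏ i with 0 < k i, br p L (y i - (t - 1)) := by
  rw [← Finset.prod_mul_distrib, Finset.prod_filter]
  refine Finset.prod_congr rfl fun i _ => ?_
  split_ifs with h
  · obtain ⟨r, hr⟩ : ∃ r, k i = r + 1 := ⟨k i - 1, by omega⟩
    rw [hr, fall_succ, add_tsub_cancel_right, hxy i, hr]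
    congr 2
    push_cast
    ring
  · rw [show k i = 0 by omega, fall_zero]

section ShiftedProducts

variable {ι : Type*} [Fintype ι] [DecidableEq ι]

theorem prod_fall_shift (p L : ℂ) {x x' : ι → ℂ} {k k' : ι → ℕ} {ν : ι} (hxν : x' ν = x ν - 1)
    (hx : ∀ i ≠ ν, x' i = x i) (hkν : k ν = k' ν + 1) (hk : ∀ i ≠ ν, k' i = k i) (t : ℂ) :
    (∏ i, fall p L (x' i - t) (k' i)) * br p L (x ν - t) = ∏ i, fall p L (x i - t) (k i) := by
  rw [← Finset.mul_prod_erase _ _ (Finset.mem_univ ν),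
    ← Finset.mul_prod_erase _ (fun i => fall p L (x i - t) (k i)) (Finset.mem_univ ν), hkν,
    fall_succ', hxν, sub_right_comm,
    Finset.prod_congr rfl fun i hi => by rw [hx i (Finset.ne_of_mem_erase hi),
      hk i (Finset.ne_of_mem_erase hi)]]
  ring

/-- Splits off the first factors instead, leaving the same product of `[x_i - t]_{k_i - 1}` as in
`prod_fall_eq_mul`. Index `ν` has nothing to split off, since `x'_ν - (t - 1) = x_ν - t` and `k'_ν =
k_ν - 1`. -/
theorem prod_fall_shift_eq_mul (p L : ℂ) {x x' : ι → ℂ} {k k' : ι → ℕ} {ν : ι}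
    (hxν : x' ν = x ν - 1) (hx : ∀ i ≠ ν, x' i = x i) (hkν : k ν = k' ν + 1)
    (hk : ∀ i ≠ ν, k' i = k i) (t : ℂ) :
    ∏ i, fall p L (x' i - (t - 1)) (k' i) =
      (∏ i with 0 < k i, fall p L (x i - t) (k i - 1)) *
        ∏ i ∈ ({i | 0 < k i} : Finset ι).erase ν, br p L (x i - (t - 1)) := by
  have hν : ν ∈ ({i | 0 < k i} : Finset ι) := by simp [hkν]
  have h1 : ∏ i, fall p L (x' i - (t - 1)) (k' i) =
      ∏ i with 0 < k i, fall p L (x' i - (t - 1)) (k' i) := by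
    rw [Finset.prod_filter]
    refine Finset.prod_congr rfl fun i _ => ?_
    split_ifs with h
    · rfl
    · have hi : i ≠ ν := fun hi => h (by rw [hi, hkν]; omega)
      rw [hk i hi, show k i = 0 by omega, fall_zero]
  rw [h1, ← Finset.mul_prod_erase _ _ hν,
    ← Finset.mul_prod_erase _ (fun i => fall p L (x i - t) (k i - 1)) hν, mul_assoc,
    ← Finset.prod_mul_distrib, hxν, hkν, add_tsub_cancel_right]
  congr 1
  · congr 1
    ring
  · refine Finset.prod_congr rfl fun i hi => ?_
    have hi' := Finset.ne_of_mem_erase hi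
    have hi2 : 0 < k i := by simpa using Finset.mem_of_mem_erase hi
    obtain ⟨r, hr⟩ : ∃ r, k i = r + 1 := ⟨k i - 1, by omega⟩
    rw [hx i hi', hk i hi', hr, fall_succ', add_tsub_cancel_right, mul_comm]
    congr 2
    ring

/-- The factorized product as a function of the complex coordinates. -/
def factProd (p L : ℂ) (x y t : ι → ℂ) (k : ι → ℕ) : ℂ :=
  ∏ i, ∏ j, fall p L (x i - t j) (k i) / fall p L (x i - y j) (k i)

/-- The induction step for the weights, free of paths. All terms share the factor `R / Q`, and what
remains is `partial_fractions` with `z = t μ - 1`. -/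
theorem sum_factProd_shift {p L : ℂ} (hp : ‖p‖ < 1) (hp0 : p ≠ 0) {x y t t' : ι → ℂ} {k : ι → ℕ}
    (x' : ι → ι → ℂ) (k' : ι → ι → ℕ) (μ : ι) (hxy : ∀ i, x i = y i + k i)
    (hxν : ∀ ν, x' ν ν = x ν - 1) (hx : ∀ ν, ∀ i ≠ ν, x' ν i = x i)
    (hkν : ∀ ν, 0 < k ν → k ν = k' ν ν + 1) (hk : ∀ ν, ∀ i ≠ ν, k' ν i = k i)
    (htμ : t' μ = t μ - 1) (ht : ∀ j ≠ μ, t' j = t j) (hpos : 0 < ∑ i, k i)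
    (hgen : ∀ i j, i ≠ j → br p L (x i - x j) ≠ 0)
    (hfall : ∀ i j, fall p L (x i - y j) (k i) ≠ 0)
    (hbr : ∀ r : ℕ, 1 ≤ r → r ≤ ∑ i, k i → br p L r ≠ 0) :
    ∑ ν with 0 < k ν, br p L 1 * factProd p L (x' ν) y t' (k' ν) *
        (br p L (x ν - (t μ - 1) - (∑ i, k i : ℕ)) *
          (∏ j ∈ Finset.univ.erase μ, br p L (x ν - t j)) / ∏ j, br p L (x ν - x' ν j)) =
      br p L (∑ i, k i : ℕ) * factProd p L x y t k := by
  -- Indices with `k i = 0` have `x i = y i`; they must be left out because `[x i - y i] = 0` would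
  -- violate the condition on partial sums.
  set T : Finset ι := {i | 0 < k i} with hT
  set z := t μ - 1
  have hsum : ∀ U : Finset ι, ∑ i ∈ U, (x i - y i) = (∑ i ∈ U, k i : ℕ) := fun U => by
    push_cast
    exact Finset.sum_congr rfl fun i _ => by rw [hxy]; ring
  have hsumT : ∑ i ∈ T, k i = ∑ i, k i := by
    refine Finset.sum_subset (Finset.subset_univ _) fun i _ hi => ?_
    have : ¬ 0 < k i := by simpa [hT] using hi
    omega
  have hTne : T.Nonempty := by
    by_contra h
    rw [Finset.not_nonempty_iff_eq_empty.1 h, Finset.sum_empty] at hsumT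
    omega
  have hpf := partial_fractions (br_neg p L) (fun a b y s z => br_three_term hp hp0 L a b y s z)
    x y z T hTne (fun i _ j _ h => hgen i j h) (fun U hU hUne => by
      rw [hsum]
      refine hbr _ ?_ ?_
      · refine Nat.succ_le_of_lt (Finset.sum_pos (fun i hi => ?_) hUne)
        simpa [hT] using hU hi
      · rw [← hsumT]
        exact Finset.sum_le_sum_of_subset hU)
  rw [hsum, hsumT] at hpf
  set Q := ∏ i, ∏ j, fall p L (x i - y j) (k i) with hQ
  have hQ0 : Q ≠ 0 := Finset.prod_ne_zero_iff.2 fun i _ => Finset.prod_ne_zero_iff.2 fun j _ =>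
    hfall i j
  set R := (∏ j ∈ Finset.univ.erase μ, ∏ i, fall p L (x i - t j) (k i)) *
    ∏ i ∈ T, fall p L (x i - t μ) (k i - 1) with hR
  have hF : factProd p L x y t k = R * (∏ i ∈ T, br p L (y i - z)) / Q := by
    simp only [factProd, Finset.prod_div_distrib]
    rw [Finset.prod_comm, ← Finset.mul_prod_erase _ _ (Finset.mem_univ μ),
      prod_fall_eq_mul p L hxy]
    ring
  have hF' : ∀ ν ∈ T, factProd p L (x' ν) y t' (k' ν) *
      ∏ j ∈ Finset.univ.erase μ, br p L (x ν - t j) =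
      R * (∏ i ∈ T.erase ν, br p L (x i - z)) * (∏ j, br p L (x ν - y j)) / Q := by
    intro ν hν
    have hν' : 0 < k ν := by simpa [hT] using hν
    have h1 : (∏ i, ∏ j, fall p L (x' ν i - y j) (k' ν i)) * ∏ j, br p L (x ν - y j) = Q := by
      rw [hQ, Finset.prod_comm, ← Finset.prod_mul_distrib, Finset.prod_comm]
      exact Finset.prod_congr rfl fun j _ =>
        prod_fall_shift p L (hxν ν) (hx ν) (hkν ν hν') (hk ν) (y j)
    have h6 : ∀ j ∈ Finset.univ.erase μ,
        (∏ i, fall p L (x' ν i - t' j) (k' ν i)) * br p L (x ν - t j) =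
          ∏ i, fall p L (x i - t j) (k i) := fun j hj => by
      rw [ht j (Finset.ne_of_mem_erase hj),
        prod_fall_shift p L (hxν ν) (hx ν) (hkν ν hν') (hk ν) (t j)]
    have h2 : (∏ i, ∏ j, fall p L (x' ν i - t' j) (k' ν i)) *
        ∏ j ∈ Finset.univ.erase μ, br p L (x ν - t j) =
        R * ∏ i ∈ T.erase ν, br p L (x i - z) := by
      rw [Finset.prod_comm, ← Finset.mul_prod_erase _ _ (Finset.mem_univ μ), htμ,
        prod_fall_shift_eq_mul p L (hxν ν) (hx ν) (hkν ν hν') (hk ν) (t μ), mul_assoc,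
        ← Finset.prod_mul_distrib, hR, Finset.prod_congr rfl h6]
      ring
    have h3 := hQ0
    rw [← h1] at h3
    have h4 := left_ne_zero_of_mul h3
    have h5 := right_ne_zero_of_mul h3
    simp only [factProd, Finset.prod_div_distrib]
    rw [← h2, ← h1]
    field_simp
  have h1 : br p L 1 ≠ 0 := by simpa using hbr 1 le_rfl hpos
  have hT' : ∀ ν ∈ T, (∏ j, br p L (x ν - y j)) / ∏ j ∈ Finset.univ.erase ν, br p L (x ν - x j) =
      (∏ j ∈ T, br p L (x ν - y j)) / ∏ j ∈ T.erase ν, br p L (x ν - x j) := by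
    intro ν hν
    have e1 : ∏ j ∈ Tᶜ, br p L (x ν - y j) = ∏ j ∈ Tᶜ, br p L (x ν - x j) := by
      refine Finset.prod_congr rfl fun j hj => ?_
      have : k j = 0 := by simpa [hT] using hj
      rw [hxy j, this, Nat.cast_zero, add_zero]
    have e2 : (Finset.univ.erase ν : Finset ι) = T.erase ν ∪ Tᶜ := by
      ext j
      by_cases hj : j ∈ T
      · simp [hj]
      · have : j ≠ ν := fun h => hj (h ▸ hν)
        simp [hj, this]
    have e3 : Disjoint (T.erase ν) Tᶜ :=
      disjoint_compl_right.mono_left (Finset.erase_subset ν T)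
    have e4 : ∏ j ∈ Tᶜ, br p L (x ν - x j) ≠ 0 := Finset.prod_ne_zero_iff.2 fun j hj =>
      hgen _ _ fun h => Finset.mem_compl.1 hj (h ▸ hν)
    rw [e2, Finset.prod_union e3, ← Finset.prod_mul_prod_compl T, e1, mul_div_mul_right _ _ e4]
  rw [hF, ← mul_div_assoc, mul_left_comm, hpf, Finset.mul_sum, Finset.sum_div]
  refine Finset.sum_congr rfl fun ν hν => ?_
  -- The diagonal factor `[1]` here is the source of the normalization `[1]^l`.
  have h2 : ∏ j, br p L (x ν - x' ν j) =
      br p L 1 * ∏ j ∈ Finset.univ.erase ν, br p L (x ν - x j) := by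
    rw [← Finset.mul_prod_erase _ _ (Finset.mem_univ ν), hxν, sub_sub_cancel]
    congr 1
    exact Finset.prod_congr rfl fun j hj => by rw [hx ν j (Finset.ne_of_mem_erase hj)]
  have h3 : ∏ j ∈ Finset.univ.erase ν, br p L (x ν - x j) ≠ 0 :=
    Finset.prod_ne_zero_iff.2 fun j hj => hgen _ _ (Finset.ne_of_mem_erase hj).symm
  rw [← hT' ν hν, h2]
  have h4 := hF' ν hν
  generalize factProd p L (x' ν) y t' (k' ν) = F at *
  field_simp
  rw [eq_div_iff hQ0] at h4
  linear_combination br p L (x ν - z - (∑ i, k i : ℕ)) * h4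

end ShiftedProducts

/-! ### Unit steps and lattice paths -/

theorem single_mem_B_one {n : ℕ} (ν : Fin (n + 1)) : (Pi.single ν 1 : State n) ∈ B n 1 := by
  refine ⟨fun i => ?_, by simp⟩
  by_cases h : i = ν
  · subst h; simp
  · simp [h]

theorem exists_eq_single_of_mem_B_one {n : ℕ} {α : State n} (h : α ∈ B n 1) :
    ∃ ν, α = Pi.single ν 1 := by
  obtain ⟨h0, hs⟩ := h
  obtain ⟨ν, -, hν⟩ := Finset.exists_ne_zero_of_sum_ne_zero
    (show ∑ i, α i ≠ 0 by rw [hs]; norm_num)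
  have h1 := h0 ν
  have h2 : ∑ i ∈ Finset.univ.erase ν, α i + α ν = 1 := by
    rw [Finset.sum_erase_add _ _ (Finset.mem_univ ν), hs, Nat.cast_one]
  have h3 : 0 ≤ ∑ i ∈ Finset.univ.erase ν, α i := Finset.sum_nonneg fun i _ => h0 i
  have h4 : ∑ i ∈ Finset.univ.erase ν, α i = 0 := by omega
  refine ⟨ν, funext fun i => ?_⟩
  by_cases hi : i = ν
  · subst hi
    rw [Pi.single_eq_same]
    omega
  · rw [Pi.single_eq_of_ne hi]
    exact (Finset.sum_eq_zero_iff_of_nonneg fun i _ => h0 i).1 h4 i (by simp [hi])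

theorem B_add {n k l : ℕ} {α β : State n} (hα : α ∈ B n k) (hβ : β ∈ B n l) :
    α + β ∈ B n (k + l) :=
  ⟨fun i => add_nonneg (hα.1 i) (hβ.1 i), by
    simp only [Pi.add_apply, Finset.sum_add_distrib, hα.2, hβ.2, Nat.cast_add]⟩

theorem init_mem_paths {n l : ℕ} {x y : State n} {s : Fin (l + 2) → State n}
    (hs : s ∈ paths (l + 1) x y) : Fin.init s ∈ paths l x (s (Fin.last l).castSucc) :=
  ⟨hs.1, rfl, fun i => hs.2.2 i.castSucc⟩

theorem sub_mem_B_of_mem_paths {n l : ℕ} {x y : State n} {s : Fin (l + 1) → State n}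
    (hs : s ∈ paths l x y) : y - x ∈ B n l := by
  induction l generalizing y with
  | zero =>
    have h : x = y := hs.1.symm.trans hs.2.1
    subst h
    simp [B]
  | succ l ih =>
    have h1 := ih (init_mem_paths hs)
    have h2 := hs.2.2 (Fin.last l)
    rw [Fin.succ_last, hs.2.1] at h2
    have h3 := B_add h2 h1
    rwa [sub_add_sub_cancel, add_comm 1 l] at h3

theorem snoc_mem_paths {n l : ℕ} {x y y' : State n} {s : Fin (l + 1) → State n}
    (hs : s ∈ paths l x y') (h : y - y' ∈ B n 1) :
    (Fin.snoc s y : Fin (l + 2) → State n) ∈ paths (l + 1) x y := by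
  refine ⟨?_, by simp, fun i => ?_⟩
  · rw [← Fin.castSucc_zero, Fin.snoc_castSucc, hs.1]
  · refine Fin.lastCases ?_ (fun i => ?_) i
    · rw [Fin.succ_last, Fin.snoc_last, Fin.snoc_castSucc, hs.2.1]
      exact h
    · rw [Fin.succ_castSucc, Fin.snoc_castSucc, Fin.snoc_castSucc]
      exact hs.2.2 i

/-- Summation over paths, sorted by the last step. -/
theorem sum_paths_succ {n l : ℕ} (b c : State n) (G : (Fin (l + 2) → State n) → ℂ) :
    ∑ s ∈ (paths_finite (l + 1) b c).toFinset, G s =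
      ∑ ν, ∑ s ∈ (paths_finite l b (c - Pi.single ν 1)).toFinset, G (Fin.snoc s c) := by
  rw [Finset.sum_sigma']
  symm
  refine Finset.sum_bij (fun x _ => Fin.snoc x.2 c) ?_ ?_ ?_ (fun _ _ => rfl)
  · rintro ⟨ν, s⟩ h
    simp only [Finset.mem_sigma, Finset.mem_univ, true_and, Set.Finite.mem_toFinset] at h ⊢
    refine snoc_mem_paths h ?_
    rw [sub_sub_cancel]
    exact single_mem_B_one ν
  · rintro ⟨ν, s⟩ h ⟨ν', s'⟩ h' heq
    simp only [Finset.mem_sigma, Finset.mem_univ, true_and, Set.Finite.mem_toFinset] at h h'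
    have h1 : s = s' := by
      have := congrArg Fin.init heq
      simpa only [Fin.init_snoc] using this
    subst h1
    have h2 := h.2.1.symm.trans h'.2.1
    have h3 : (Pi.single ν 1 : State n) = Pi.single ν' 1 := sub_right_injective h2
    have h4 : ν = ν' := by
      by_contra hne
      have := congrFun h3 ν
      rw [Pi.single_eq_same, Pi.single_eq_of_ne hne] at this
      exact one_ne_zero this
    rw [h4]
  · intro s hs
    rw [Set.Finite.mem_toFinset] at hs
    have h2 := hs.2.2 (Fin.last l)
    rw [Fin.succ_last, hs.2.1] at h2
    obtain ⟨ν, hν⟩ := exists_eq_single_of_mem_B_one h2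
    refine ⟨⟨ν, Fin.init s⟩, ?_, ?_⟩
    · simp only [Finset.mem_sigma, Finset.mem_univ, true_and, Set.Finite.mem_toFinset]
      rw [← hν, sub_sub_cancel]
      exact init_mem_paths hs
    · rw [← hs.2.1]
      exact Fin.snoc_init_self s

/-! ### Recursion and factorization of the fused weights -/

variable {n : ℕ} (p L : ℂ) (η : Fin (n + 1) → ℂ)

theorem Wbar_succ {l m : ℕ} {A : Fin (l + 2) → State n} {a b d c : State n}
    (hface : IsFace (l + 1) m a b d c) (hA : A ∈ paths (l + 1) a d) (u : ℂ) :
    Wbar p L η (l + 1) m A a b d c u =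
      ∑ ν, Wbar p L η l m (Fin.init A) a b (A (Fin.last l).castSucc) (c - Pi.single ν 1) u *
        WbarOne p L η m (A (Fin.last l).castSucc) (c - Pi.single ν 1) d c (u - (l : ℕ)) := by
  rw [Wbar, if_pos hface, sum_paths_succ]
  refine Finset.sum_congr rfl fun ν _ => ?_
  have h1 : ∀ s ∈ (paths_finite l b (c - Pi.single ν 1)).toFinset,
      ∏ i : Fin (l + 1), WbarOne p L η m (A i.castSucc)
        ((Fin.snoc s c : Fin (l + 2) → State n) i.castSucc) (A i.succ)
        ((Fin.snoc s c : Fin (l + 2) → State n) i.succ) (u - (i : ℕ)) =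
      (∏ i : Fin l, WbarOne p L η m (Fin.init A i.castSucc) (s i.castSucc) (Fin.init A i.succ)
        (s i.succ) (u - (i : ℕ))) *
        WbarOne p L η m (A (Fin.last l).castSucc) (c - Pi.single ν 1) d c (u - (l : ℕ)) := by
    intro s hs
    rw [Set.Finite.mem_toFinset] at hs
    rw [Fin.prod_univ_castSucc, Fin.snoc_castSucc, Fin.succ_last, Fin.snoc_last, hs.2.1, hA.2.1,
      Fin.val_last]
    congr 1
    refine Finset.prod_congr rfl fun i _ => ?_
    rw [Fin.succ_castSucc, Fin.snoc_castSucc, Fin.snoc_castSucc]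
    rfl
  rw [Finset.sum_congr rfl h1, ← Finset.sum_mul, Wbar]
  split_ifs with hf
  · rfl
  · rw [zero_mul]
    -- If a path exists, the smaller face can fail only at its lower edge. That edge is the upper
    -- edge of the last single face, whose weight is then zero.
    rcases (paths_finite l b (c - Pi.single ν 1)).toFinset.eq_empty_or_nonempty with he | ⟨s, hs⟩
    · rw [he, Finset.sum_empty, zero_mul]
    · rw [Set.Finite.mem_toFinset] at hs
      rw [WbarOne, if_neg, mul_zero]
      intro h
      exact hf ⟨sub_mem_B_of_mem_paths (init_mem_paths hA), h.2.2.2, sub_mem_B_of_mem_paths hs,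
        hface.2.2.2⟩

/-- Both ends of each difference move by one step, so `c` and `d` can replace `b` and `a`; this is
the shape needed for `sum_factProd_shift`. -/
theorem WbarOne_eq {m : ℕ} {a b d c : State n} {μ ν : Fin (n + 1)} (hface : IsFace 1 m a b d c)
    (hd : d = a + Pi.single μ 1) (hc : c = b + Pi.single ν 1) (u : ℂ) :
    WbarOne p L η m a b d c u =
      br p L (u + coord η c ν - coord η d μ) *
        (∏ j ∈ Finset.univ.erase μ, br p L (coord η c ν - coord η d j)) /
          ∏ j, br p L (coord η c ν - coord η b j) := by
  have hinj : ∀ i j : Fin (n + 1), (Pi.single i 1 : State n) = Pi.single j 1 → i = j := by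
    intro i j h
    by_contra hne
    have := congrFun h i
    rw [Pi.single_eq_same, Pi.single_eq_of_ne hne] at this
    exact one_ne_zero this
  rw [WbarOne, if_pos hface, Finset.sum_eq_single μ, Finset.sum_eq_single ν, if_pos ⟨hd, hc⟩]
  · have h1 : u + coord η b ν - coord η a μ = u + coord η c ν - coord η d μ := by
      simp only [coord, hc, hd, Pi.add_apply, Pi.single_eq_same]
      push_cast
      ring
    rw [h1]
    congr 2
    refine Finset.prod_congr rfl fun j hj => ?_
    congr 1
    simp only [coord, hc, hd, Pi.add_apply, Pi.single_eq_same,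
      Pi.single_eq_of_ne (Finset.ne_of_mem_erase hj)]
    push_cast
    ring
  · intro ν' _ hν'
    rw [if_neg]
    rintro ⟨-, h⟩
    exact hν' (hinj _ _ (add_left_cancel (h.symm.trans hc)))
  · simp
  · intro μ' _ hμ'
    refine Finset.sum_eq_zero fun ν' _ => ?_
    rw [if_neg]
    rintro ⟨h, -⟩
    exact hμ' (hinj _ _ (add_left_cancel (h.symm.trans hd)))
  · simp

/-- If the lower edge of a face is admissible but the upper edge is not, then the expression for
the weight of the face vanishes. -/
theorem prod_br_eq_zero {m : ℕ} {a b d c : State n} {μ ν : Fin (n + 1)} (hcd : c - d ∈ B n m)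
    (hd : d = a + Pi.single μ 1) (hc : c = b + Pi.single ν 1) (h : b - a ∉ B n m) :
    ∏ j ∈ Finset.univ.erase μ, br p L (coord η c ν - coord η d j) = 0 := by
  have hba : b - a = c - d + Pi.single μ 1 - Pi.single ν 1 := by rw [hd, hc]; abel
  have hsum : ∑ i, (b - a) i = m := by
    rw [hba]
    simp only [Pi.sub_apply, Pi.add_apply, Finset.sum_sub_distrib, Finset.sum_add_distrib,
      Finset.sum_pi_single', Finset.mem_univ, if_true]
    have := hcd.2
    simp only [Pi.sub_apply, Finset.sum_sub_distrib] at this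
    rw [this]
    ring
  obtain ⟨j, hj⟩ : ∃ j, (b - a) j < 0 := by
    by_contra! h0
    exact h ⟨h0, hsum⟩
  have hj' := congrFun hba j
  have hcdj := hcd.1 j
  simp only [Pi.sub_apply, Pi.add_apply] at hj hj' hcdj
  have hjν : j = ν := by
    by_contra hne
    rw [Pi.single_eq_of_ne hne] at hj'
    by_cases hjμ : j = μ
    · rw [hjμ, Pi.single_eq_same] at hj'
      rw [hjμ] at hj hcdj
      omega
    · rw [Pi.single_eq_of_ne hjμ] at hj'
      omega
  subst hjν
  have hjμ : j ≠ μ := by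
    rintro rfl
    rw [Pi.single_eq_same] at hj'
    omega
  rw [Pi.single_eq_same, Pi.single_eq_of_ne hjμ] at hj'
  have hcd0 : c j = d j := by omega
  refine Finset.prod_eq_zero (Finset.mem_erase.2 ⟨hjμ, Finset.mem_univ j⟩) ?_
  rw [coord, coord, hcd0, sub_self, br_zero]

variable {p L η}

/-- Diagonal factors are `[r]` with `1 ≤ r ≤ l`; off the diagonal, genericity of `η` applies. -/
theorem fall_coord_ne_zero {b c : State n} {l : ℕ}
    (hη : ∀ i j : Fin (n + 1), i ≠ j → ∀ k : ℤ, br p L (η i - η j + k) ≠ 0)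
    (hbr : ∀ r : ℕ, 1 ≤ r → r ≤ l → br p L r ≠ 0) (hcb : c - b ∈ B n l) (i j : Fin (n + 1)) :
    fall p L (coord η c i - coord η b j) (c i - b i).toNat ≠ 0 := by
  have h0 : 0 ≤ c i - b i := hcb.1 i
  refine Finset.prod_ne_zero_iff.2 fun t ht => ?_
  rw [Finset.mem_range] at ht
  by_cases hij : i = j
  · subst hij
    have h1 : c i - b i ≤ l := by
      rw [← hcb.2]
      exact Finset.single_le_sum (f := (c - b)) (fun i _ => hcb.1 i) (Finset.mem_univ i)
    obtain ⟨r, hr⟩ : ∃ r : ℕ, c i - b i - t = r := ⟨(c i - b i - t).toNat, by omega⟩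
    have h2 : coord η c i - coord η b i - t = r := by
      rw [← Int.cast_natCast r, ← hr]
      simp only [coord]
      push_cast
      ring
    rw [h2]
    exact hbr r (by omega) (by omega)
  · have h2 : coord η c i - coord η b j - t = η i - η j + (c i - b j - t : ℤ) := by
      simp only [coord]
      push_cast
      ring
    rw [h2]
    exact hη i j hij _

/-- The fused weight factorizes at `u = 0`. -/
theorem Wbar_mul_pow (hp : ‖p‖ < 1) (hp0 : p ≠ 0)
    (hη : ∀ i j : Fin (n + 1), i ≠ j → ∀ k : ℤ, br p L (η i - η j + k) ≠ 0) (m : ℕ) {l : ℕ}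
    (hbr : ∀ r : ℕ, 1 ≤ r → r ≤ l → br p L r ≠ 0) {A : Fin (l + 1) → State n} {a b d c : State n}
    (hface : IsFace l m a b d c) (hA : A ∈ paths l a d) :
    Wbar p L η l m A a b d c 0 * br p L 1 ^ l = fall p L l l *
      factProd p L (coord η c) (coord η b) (coord η d) (fun i => (c i - b i).toNat) := by
  induction l generalizing d c with
  | zero =>
    have hcb : c = b := by
      have h0 := hface.2.2.1
      have h1 := (Finset.sum_eq_zero_iff_of_nonneg fun i _ => h0.1 i).1 (h0.2.trans Nat.cast_zero)
      exact sub_eq_zero.1 (funext fun i => h1 i (Finset.mem_univ i))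
    subst hcb
    have h1 : (paths_finite 0 c c).toFinset = {fun _ => c} := by
      ext s
      simp only [Set.Finite.mem_toFinset, Finset.mem_singleton]
      constructor
      · intro h
        funext i
        rw [show i = 0 by omega, h.1]
      · rintro rfl
        exact ⟨rfl, rfl, fun i => i.elim0⟩
    rw [Wbar, if_pos hface, h1]
    simp [factProd, fall_zero]
  | succ l ih =>
    set d' := A (Fin.last l).castSucc with hd'
    obtain ⟨μ, hμ⟩ : ∃ μ, d - d' = Pi.single μ 1 := by
      have h2 := hA.2.2 (Fin.last l)
      rw [Fin.succ_last, hA.2.1] at h2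
      exact exists_eq_single_of_mem_B_one h2
    have hd : d = d' + Pi.single μ 1 := by rw [← hμ]; abel
    have hcb := hface.2.2.1
    set k : Fin (n + 1) → ℕ := fun i => (c i - b i).toNat with hk
    have hkcb : ∀ i, (k i : ℤ) = c i - b i := fun i => Int.toNat_of_nonneg (hcb.1 i)
    have hksum : ∑ i, k i = l + 1 := by
      have h : ((∑ i, k i : ℕ) : ℤ) = (l + 1 : ℕ) := by
        rw [← hcb.2]
        push_cast
        exact Finset.sum_congr rfl fun i _ => hkcb i
      exact_mod_cast h
    have hbr' : ∀ r : ℕ, 1 ≤ r → r ≤ l → br p L r ≠ 0 := fun r h1 h2 => hbr r h1 (by omega)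
    have hmain := sum_factProd_shift (p := p) (L := L) hp hp0 (x := coord η c) (y := coord η b)
      (t := coord η d) (t' := coord η d') (k := k)
      (fun ν => coord η (c - Pi.single ν 1))
      (fun ν i => ((c - Pi.single ν 1 : State n) i - b i).toNat) μ
      (fun i => by
        have h := congrArg (Int.cast : ℤ → ℂ) (hkcb i)
        push_cast at h
        rw [h]
        simp only [coord]
        ring)
      (fun ν => by
        simp only [coord, Pi.sub_apply, Pi.single_eq_same]
        push_cast
        ring)
      (fun ν i hi => by simp only [coord, Pi.sub_apply, Pi.single_eq_of_ne hi, sub_zero])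
      (fun ν hν => by
        have := hkcb ν
        simp only [Pi.sub_apply, Pi.single_eq_same]
        omega)
      (fun ν i hi => by simp only [hk, Pi.sub_apply, Pi.single_eq_of_ne hi, sub_zero])
      (by
        simp only [coord, hd, Pi.add_apply, Pi.single_eq_same]
        push_cast
        ring)
      (fun j hj => by simp only [coord, hd, Pi.add_apply, Pi.single_eq_of_ne hj, add_zero])
      (by omega)
      (fun i j hij => by
        have h2 : coord η c i - coord η c j = η i - η j + (c i - c j : ℤ) := by
          simp only [coord]
          push_cast
          ring
        rw [h2]
        exact hη i j hij _)
      (fun i j => fall_coord_ne_zero hη hbr hcb i j)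
      (fun r h1 h2 => hbr r h1 (hksum ▸ h2))
    rw [hksum] at hmain
    have hfall : fall p L (l + 1 : ℕ) (l + 1) = br p L (l + 1 : ℕ) * fall p L l l := by
      rw [fall_succ']
      congr 2
      push_cast
      ring
    rw [Wbar_succ p L η hface hA, ← hd', hfall, mul_right_comm, ← hmain, Finset.sum_mul,
      Finset.sum_mul, Finset.sum_filter]
    refine Finset.sum_congr rfl fun ν _ => ?_
    have hc : c = c - Pi.single ν 1 + Pi.single ν 1 := by abel
    have hd'a : d' - a ∈ B n l := sub_mem_B_of_mem_paths (init_mem_paths hA)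
    split_ifs with hν
    · have hc'b : c - Pi.single ν 1 - b ∈ B n l := by
        refine ⟨fun i => ?_, ?_⟩
        · have h1 := hkcb i
          by_cases hi : i = ν
          · subst hi
            simp only [Pi.sub_apply, Pi.single_eq_same]
            omega
          · simp only [Pi.sub_apply, Pi.single_eq_of_ne hi]
            omega
        · rw [sub_right_comm]
          have h1 := hcb.2
          simp only [Pi.sub_apply, Finset.sum_sub_distrib, Finset.sum_pi_single',
            Finset.mem_univ, if_true] at h1 ⊢
          rw [h1]
          push_cast
          ring
      by_cases hf : c - Pi.single ν 1 - d' ∈ B n m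
      · have hW := ih hbr' (d := d') (c := c - Pi.single ν 1) (A := Fin.init A)
          ⟨hd'a, hf, hc'b, hface.2.2.2⟩ (init_mem_paths hA)
        have hone : IsFace 1 m d' (c - Pi.single ν 1) d c :=
          ⟨hμ ▸ single_mem_B_one μ, hface.2.1, by
            rw [sub_sub_cancel]; exact single_mem_B_one ν, hf⟩
        -- Here `u = 0` is essential: the spectral shift `-l` matches `-(l + 1)` once `z = d_μ - 1`
        -- is introduced.
        rw [WbarOne_eq p L η hone hd hc, show (0 : ℂ) - (l : ℕ) + coord η c ν - coord η d μ =
          coord η c ν - (coord η d μ - 1) - (l + 1 : ℕ) by push_cast; ring, pow_succ]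
        linear_combination br p L 1 * (br p L (coord η c ν - (coord η d μ - 1) - (l + 1 : ℕ)) *
          (∏ j ∈ Finset.univ.erase μ, br p L (coord η c ν - coord η d j)) /
            ∏ j, br p L (coord η c ν - coord η (c - Pi.single ν 1) j)) * hW
      -- The induction hypothesis says nothing about an inadmissible intermediate face, but the
      -- corresponding partial fraction term contains `[0]`.
      · rw [Wbar, if_neg (fun h => hf h.2.1), prod_br_eq_zero p L η hface.2.1 hd hc hf]
        ring
    · rw [Wbar, if_neg]
      · ring
      · intro h
        have h1 := h.2.2.1.1 ν
        have h2 := hkcb ν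
        simp only [Pi.sub_apply, Pi.single_eq_same] at h1
        omega

end FaceModel

end

theorem theorem1 (n l m : ℕ) (hl : 0 < l) (hlm : l ≤ m)
    (p L : ℂ) (hp : ‖p‖ < 1) (hL : L ≠ 0)
    -- the elliptic binomial coefficient and its inverse are defined
    (hll : FaceModel.fall p L l l ≠ 0) (hml : FaceModel.fall p L m l ≠ 0)
    -- `η` is generic
    (η : Fin (n + 1) → ℂ)
    (hη : ∀ i j : Fin (n + 1), i ≠ j → ∀ k : ℤ, FaceModel.br p L (η i - η j + k) ≠ 0)
    (a b c d : FaceModel.State n) (hface : FaceModel.IsFace l m a b d c) :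
    -- whatever path from `a` to `d` is used to compute the fused weight
    ∀ A ∈ FaceModel.paths l a d,
      FaceModel.W p L η l m A a b d c 0 = FaceModel.S p L η l m a b d c := by
  intro A hA
  have hbr : ∀ r : ℕ, 1 ≤ r → r ≤ l → FaceModel.br p L r ≠ 0 := by
    intro r h1 h2
    -- The factors of `[l]_l` are exactly `[l], …, [1]`; the one with index `l - r` is `[r]`.
    have h := Finset.prod_ne_zero_iff.1 hll (l - r) (Finset.mem_range.2 (by omega))
    rwa [Nat.cast_sub h2, sub_sub_cancel] at h
  have hp0 : p ≠ 0 := by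
    rintro rfl
    -- At `p = 0` the prefactor `p^(1/4)` is zero, so every bracket would vanish.
    exact hbr l hl le_rfl (by simp [FaceModel.br, FaceModel.theta1])
  have h := FaceModel.Wbar_mul_pow hp hp0 hη m hbr hface hA
  rw [FaceModel.W, ← mul_div_assoc, h, mul_div_cancel_left₀ _ hll, mul_comm]
  rfl
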